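/- Let $H$ be a Lie group and let $(\pi,\mathcal H)$ be a (strongly continuous) unitary representation of $H$ on a complex Hilbert space. Let $D$ be a connected complex manifold and $\mathcal L\to D$ an $H$-equivariant holomorphic line bundle; that is, $H$ acts smoothly on $D$ and on the total space of $\mathcal L$, each $h\in H$ acts by holomorphic maps, and the action on $\mathcal L$ covers the one on $D$ and is linear on the fibres. Let $\mathcal O(\mathcal L)$ be the space of holomorphic sections of $\mathcal L$, with the topology of uniform convergence on compact sets and the action $(h\cdot s)(x)=h\cdot s(h^{-1}x)$ of $H$. Let $\sigma$ be an anti-holomorphic diffeomorphism of $D$ with $\sigma\circ\sigma=\mathrm{id}$. Let $\overline{\sigma^*\mathcal L}\to D$ be the complex conjugate of the pull-back of $\mathcal L$ along $\sigma$; it is a holomorphic line bundle whose fibre at $x$ is, as a set, $\mathcal L_{\sigma(x)}$. Assume: 1. There is an injective continuous linear $H$-intertwining map $\mathcal H\to\mathcal O(\mathcal L)$. 2. There is an isomorphism of holomorphic line bundles $\Psi:\mathcal L\to\overline{\sigma^*\mathcal L}$ over the identity of $D$ that is $H$-equivariant in the following sense: for every $h\in H$ and $v\in\mathcal L$ there is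 $h'\in H$ such that $\Psi(h\cdot v)=h'\cdot\Psi(v)$, where both sides are regarded as elements of $\mathcal L$. (If $\sigma$ commutes with the action of $H$, this holds in particular when $\Psi(h\cdot v)=h\cdot\Psi(v)$ always; if $\sigma(h\cdot x)=\varphi(h)\cdot\sigma(x)$ for an automorphism $\varphi$ of $H$, it holds in particular when $\Psi(h\cdot v)=\varphi(h)\cdot\Psi(v)$ always.) 3. For every $x\in D$ there is $g\in H$ with $\sigma(x)=g\cdot x$. Then the ring $\operatorname{End}_H(\mathcal H)$ of continuous $H$-intertwining operators on $\mathcal H$ is commutative. Consequently $(\pi,\mathcal H)$ is multiplicity-free, which by definition means that $\operatorname{End}_H(\mathcal H)$ is commutative. -/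

import Mathlib

open Bundle Manifold ContDiff Topology ComplexConjugate

noncomputable section

/-! ### The conjugate of a complex line bundle -/

section ConjugateBundle

variable {D : Type*}

/-- The conjugate bundle `L̄` of a complex line bundle `L`: the same total space and the same
additive groups as fibres, with `c ∈ ℂ` acting on `L̄ₓ` as `c̄` acts on `Lₓ`. -/
def ConjBundle (L : D → Type*) : D → Type _ := fun x => L x

variable (L : D → Type*)

instance [∀ x, AddCommGroup (L x)] (x : D) : AddCommGroup (ConjBundle L x) :=
  inferInstanceAs (AddCommGroup (L x))

instance [∀ x, AddCommGroup (L x)] [∀ x, Module ℂ (L x)] (x : D) : Module ℂ (ConjBundle L x) :=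
  Module.compHom (L x) (starRingEnd ℂ)

theorem ConjBundle.smul_def [∀ x, AddCommGroup (L x)] [∀ x, Module ℂ (L x)] {x : D} (c : ℂ)
    (v : ConjBundle L x) : c • v = (show ConjBundle L x from (conj c • (show L x from v) : L x)) :=
  rfl

instance [∀ x, TopologicalSpace (L x)] (x : D) : TopologicalSpace (ConjBundle L x) :=
  inferInstanceAs (TopologicalSpace (L x))

/-- The identity map from the total space of `L̄` to that of `L`. -/
def ConjBundle.toOriginal (p : TotalSpace ℂ (ConjBundle L)) : TotalSpace ℂ L := ⟨p.1, p.2⟩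

/-- The identity map from the total space of `L` to that of `L̄`. -/
def ConjBundle.ofOriginal (p : TotalSpace ℂ L) : TotalSpace ℂ (ConjBundle L) := ⟨p.1, p.2⟩

instance [TopologicalSpace (TotalSpace ℂ L)] : TopologicalSpace (TotalSpace ℂ (ConjBundle L)) :=
  TopologicalSpace.induced (ConjBundle.toOriginal L) inferInstance

variable [TopologicalSpace (TotalSpace ℂ L)]

theorem ConjBundle.continuous_toOriginal : Continuous (ConjBundle.toOriginal L) :=
  continuous_induced_dom

theorem ConjBundle.continuous_ofOriginal : Continuous (ConjBundle.ofOriginal L) :=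
  continuous_induced_rng.2 continuous_id

variable {L} [TopologicalSpace D]

/-- A local trivialization `v ↦ (x, e v)` of `L` gives the local trivialization `v ↦ (x, conj (e v))`
of `L̄`; so the transition functions of `L̄` are the conjugates of those of `L`. -/
def ConjBundle.trivialization (e : Trivialization ℂ (π ℂ L)) :
    Trivialization ℂ (π ℂ (ConjBundle L)) where
  toFun p := (p.1, conj (e (toOriginal L p)).2)
  invFun q := ofOriginal L (e.toPartialEquiv.symm (q.1, conj q.2))
  source := toOriginal L ⁻¹' e.source
  target := e.baseSet ×ˢ Set.univ
  map_source' p hp := by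
    have : p.1 ∈ e.baseSet := e.mem_source.1 hp
    simp [this]
  map_target' q hq := by
    have h : (q.1, conj q.2) ∈ e.target := e.mem_target.2 hq.1
    exact e.map_target h
  left_inv' p hp := by
    have h : e (toOriginal L p) = (p.1, (e (toOriginal L p)).2) :=
      Prod.ext (e.coe_fst hp) rfl
    have h2 : e.toPartialEquiv.symm (e (toOriginal L p)) = toOriginal L p := e.left_inv hp
    simp only [Complex.conj_conj]
    rw [← h, h2]
    rfl
  right_inv' q hq := by
    have h : (q.1, conj q.2) ∈ e.target := e.mem_target.2 hq.1
    have h2 : e (e.toPartialEquiv.symm (q.1, conj q.2)) = (q.1, conj q.2) := e.right_inv h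
    have h3 : (e.toPartialEquiv.symm (q.1, conj q.2)).1 = q.1 := e.proj_symm_apply h
    refine Prod.ext h3 ?_
    change conj (e (e.toPartialEquiv.symm (q.1, conj q.2))).2 = q.2
    rw [h2]; simp
  open_source := e.open_source.preimage (continuous_toOriginal L)
  open_target := e.open_baseSet.prod isOpen_univ
  continuousOn_toFun := by
    have h : ContinuousOn (fun p : TotalSpace ℂ (ConjBundle L) => e (toOriginal L p))
        (toOriginal L ⁻¹' e.source) :=
      e.continuousOn.comp (continuous_toOriginal L).continuousOn fun _ h => h
    have h2 : ContinuousOn (fun p : TotalSpace ℂ (ConjBundle L) =>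
        ((e (toOriginal L p)).1, conj (e (toOriginal L p)).2)) (toOriginal L ⁻¹' e.source) :=
      h.fst.prodMk (Complex.continuous_conj.comp_continuousOn h.snd)
    exact h2.congr fun p hp => Prod.ext (e.coe_fst hp).symm rfl
  continuousOn_invFun := by
    refine (continuous_ofOriginal L).comp_continuousOn ?_
    refine e.continuousOn_invFun.comp (t := e.target) ?_ ?_
    · exact (continuous_fst.prodMk (Complex.continuous_conj.comp continuous_snd)).continuousOn
    · intro q hq
      exact e.mem_target.2 hq.1
  baseSet := e.baseSet
  open_baseSet := e.open_baseSet
  source_eq := by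
    ext p
    exact e.mem_source
  target_eq := rfl
  proj_toFun _ _ := rfl

variable [∀ x, AddCommGroup (L x)] [∀ x, Module ℂ (L x)]

theorem ConjBundle.trivialization_isLinear (e : Trivialization ℂ (π ℂ L)) [e.IsLinear ℂ] :
    (ConjBundle.trivialization e).IsLinear ℂ where
  linear x hx := by
    have h := e.linear ℂ (b := x) hx
    refine ⟨fun v w => ?_, fun c v => ?_⟩
    · have := h.map_add v w
      change conj (e ⟨x, (v + w : L x)⟩).2 = conj (e ⟨x, v⟩).2 + conj (e ⟨x, w⟩).2
      rw [← map_add]; exact congrArg _ this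
    · have := h.map_smul (conj c) (show L x from v)
      rw [ConjBundle.smul_def]
      refine (congrArg conj this).trans ?_
      simp only [smul_eq_mul, map_mul, Complex.conj_conj]
      rfl

variable [∀ x, TopologicalSpace (L x)] [FiberBundle ℂ L]

instance ConjBundle.fiberBundle : FiberBundle ℂ (ConjBundle L) where
  totalSpaceMk_isInducing' x := by
    have h : IsInducing (toOriginal L) := ⟨rfl⟩
    exact h.of_comp_iff.1 (FiberBundle.totalSpaceMk_isInducing ℂ L x)
  trivializationAtlas' := ConjBundle.trivialization '' trivializationAtlas ℂ L
  trivializationAt' x := ConjBundle.trivialization (trivializationAt ℂ L x)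
  mem_baseSet_trivializationAt' x := mem_baseSet_trivializationAt ℂ L x
  trivialization_mem_atlas' x := ⟨_, trivialization_mem_atlas ℂ L x, rfl⟩

instance ConjBundle.vectorBundle [VectorBundle ℂ ℂ L] : VectorBundle ℂ ℂ (ConjBundle L) where
  trivialization_linear' := by
    rintro _ ⟨e, he, rfl⟩
    have : MemTrivializationAtlas e := ⟨he⟩
    exact ConjBundle.trivialization_isLinear e
  continuousOn_coordChange' := by
    rintro _ _ ⟨e, he, rfl⟩ ⟨e', he', rfl⟩
    have : MemTrivializationAtlas e := ⟨he⟩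
    have : MemTrivializationAtlas e' := ⟨he'⟩
    have := ConjBundle.trivialization_isLinear e
    have := ConjBundle.trivialization_isLinear e'
    have h := (continuousOn_coordChange ℂ e e').clm_apply (continuousOn_const (c := (1 : ℂ)))
    have h2 := Complex.continuous_conj.comp_continuousOn h
    have h3 : ContinuousOn (fun x => (ContinuousLinearMap.toSpanSingleton ℂ
        (conj (e.coordChangeL ℂ e' x (1 : ℂ))) : ℂ →L[ℂ] ℂ)) (e.baseSet ∩ e'.baseSet) :=
      ((ContinuousLinearMap.toSpanSingletonCLE (𝕜 := ℂ) (E := ℂ)).continuous.comp_continuousOn h2)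
    refine h3.congr fun x hx => ?_
    refine ContinuousLinearMap.ext_ring ?_
    change (ConjBundle.trivialization e).coordChangeL ℂ (ConjBundle.trivialization e') x 1 = _
    rw [Trivialization.coordChangeL_apply' (ConjBundle.trivialization e)
      (ConjBundle.trivialization e') hx]
    change _ = (1 : ℂ) • conj (e.coordChangeL ℂ e' x (1 : ℂ))
    rw [Trivialization.coordChangeL_apply' e e' hx, one_smul]
    change conj (e' (e.toPartialEquiv.symm (x, conj 1))).2 = _
    rw [map_one]
    rfl

end ConjugateBundle

/-! ### Holomorphic line bundles and their sections

A complex manifold `D` is modelled on a finite-dimensional complex normed space `E`, with complex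
analytic transition maps; "holomorphic" is `ContMDiff … ω` over `ℂ`.  The same charts, regarded over
`ℝ`, make `D` a smooth real manifold with model `𝓘(ℝ, E)`, and likewise for total spaces. -/

section LineBundle

variable (E : Type*) [NormedAddCommGroup E] [NormedSpace ℂ E]
  {D : Type*} [TopologicalSpace D] [ChartedSpace E D]

/-- A self-map of a complex manifold is anti-holomorphic: it is smooth and its (real) differential
at each point is conjugate-linear. -/
structure IsAntiholomorphic (σ : D → D) : Prop where
  contMDiff : ContMDiff 𝓘(ℝ, E) 𝓘(ℝ, E) ∞ σ
  mfderiv_conj : ∀ (x : D) (c : ℂ) (v : E),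
    (show E →L[ℝ] E from mfderiv 𝓘(ℝ, E) 𝓘(ℝ, E) σ x) (c • v) =
      conj c • (show E →L[ℝ] E from mfderiv 𝓘(ℝ, E) 𝓘(ℝ, E) σ x) v

section Sections

variable (L : D → Type*) [TopologicalSpace (TotalSpace ℂ L)] [∀ x, TopologicalSpace (L x)]
  [FiberBundle ℂ L]

/-- The space `𝒪(L)` of holomorphic sections of `L`. -/
abbrev HolomorphicSection : Type _ := ContMDiffSection 𝓘(ℂ, E) ℂ ω L

variable {E L}

/-- A holomorphic section as a continuous map into the total space. -/
def HolomorphicSection.toContinuousMap (s : HolomorphicSection E L) : C(D, TotalSpace ℂ L) :=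
  ⟨fun x => ⟨x, s x⟩, s.contMDiff.continuous⟩

/-- `𝒪(L)` carries the topology of uniform convergence on compact sets, that is, the compact-open
topology of maps from `D` to the total space of `L`. -/
instance HolomorphicSection.topologicalSpace : TopologicalSpace (HolomorphicSection E L) :=
  TopologicalSpace.induced HolomorphicSection.toContinuousMap ContinuousMap.compactOpen

end Sections

/-- An isomorphism (over the identity of `D`) of holomorphic line bundles. -/
structure HolomorphicLineBundleIso
    (L : D → Type*) [∀ x, AddCommMonoid (L x)] [∀ x, Module ℂ (L x)]
    [TopologicalSpace (TotalSpace ℂ L)] [∀ x, TopologicalSpace (L x)] [FiberBundle ℂ L]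
    (L' : D → Type*) [∀ x, AddCommMonoid (L' x)] [∀ x, Module ℂ (L' x)]
    [TopologicalSpace (TotalSpace ℂ L')] [∀ x, TopologicalSpace (L' x)] [FiberBundle ℂ L'] where
  fiberEquiv : ∀ x, L x ≃ₗ[ℂ] L' x
  holomorphic : ContMDiff (𝓘(ℂ, E).prod 𝓘(ℂ, ℂ)) (𝓘(ℂ, E).prod 𝓘(ℂ, ℂ)) ω
    (fun v : TotalSpace ℂ L => (⟨v.1, fiberEquiv v.1 v.2⟩ : TotalSpace ℂ L'))
  holomorphic_symm : ContMDiff (𝓘(ℂ, E).prod 𝓘(ℂ, ℂ)) (𝓘(ℂ, E).prod 𝓘(ℂ, ℂ)) ω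
    (fun v : TotalSpace ℂ L' => (⟨v.1, (fiberEquiv v.1).symm v.2⟩ : TotalSpace ℂ L))

section Equivariant

variable (EH : Type*) [NormedAddCommGroup EH] [NormedSpace ℝ EH]
  (H : Type*) [Group H] [TopologicalSpace H] [ChartedSpace EH H] [MulAction H D]
  (L : D → Type*) [∀ x, AddCommGroup (L x)] [∀ x, Module ℂ (L x)]
  [TopologicalSpace (TotalSpace ℂ L)] [∀ x, TopologicalSpace (L x)] [FiberBundle ℂ L]
  [MulAction H (TotalSpace ℂ L)]

/-- The Lie group `H` (modelled on `EH`) acts smoothly on the complex manifold `D` and on the total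
space of the holomorphic line bundle `L → D`; each `h ∈ H` acts by holomorphic maps, and its action
on `L` covers its action on `D` and is linear on fibres. -/
structure IsEquivariantHolomorphicLineBundle : Prop where
  smooth_base : ContMDiff (𝓘(ℝ, EH).prod 𝓘(ℝ, E)) 𝓘(ℝ, E) ∞ (fun p : H × D => p.1 • p.2)
  smooth_total : ContMDiff (𝓘(ℝ, EH).prod (𝓘(ℝ, E).prod 𝓘(ℝ, ℂ))) (𝓘(ℝ, E).prod 𝓘(ℝ, ℂ)) ∞
    (fun p : H × TotalSpace ℂ L => p.1 • p.2)
  holomorphic_base : ∀ h : H, ContMDiff 𝓘(ℂ, E) 𝓘(ℂ, E) ω (fun x : D => h • x)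
  holomorphic_total : ∀ h : H, ContMDiff (𝓘(ℂ, E).prod 𝓘(ℂ, ℂ)) (𝓘(ℂ, E).prod 𝓘(ℂ, ℂ)) ω
    (fun v : TotalSpace ℂ L => h • v)
  fiber_linear : ∀ (h : H) (x : D), ∃ ℓ : L x →ₗ[ℂ] L (h • x),
    ∀ v : L x, h • (⟨x, v⟩ : TotalSpace ℂ L) = ⟨h • x, ℓ v⟩

variable {E L}

/-- For `Ψ : L ≅ (σ*L)‾`, the fibre of `(σ*L)‾` at `x` is, as a set, the fibre of `L` at `σ x`; so
`Ψ` can be read as a map of `L` to itself, covering `σ` and conjugate-linear on fibres. -/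
def HolomorphicLineBundleIso.lift {σ : C(D, D)}
    (Ψ : HolomorphicLineBundleIso E L (σ *ᵖ (ConjBundle L))) (v : TotalSpace ℂ L) :
    TotalSpace ℂ L :=
  ⟨σ v.1, Ψ.fiberEquiv v.1 v.2⟩

/-- Compatibility of `Ψ : L ≅ (σ*L)‾` with the actions of `H`.  The element `h` acts from the fibre
of `(σ*L)‾` at `x`, which is that of `L` at `σ x`, to the fibre at `h • x`, which is that of `L` at
`σ (h • x)`, through some element `h'` of `H`, and `Ψ` intertwines the two.  We let `h'` depend on
both `h` and the point.  If `σ` commutes with `H`, then `h' = h` is the plain equivariance of `Ψ`;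
if `σ (h • x) = φ h • σ x` for an automorphism `φ` of `H`, then `h' = φ h` is the equivariance of
`Ψ` for the natural action of `H` on `(σ*L)‾` twisted by `φ`. -/
def HolomorphicLineBundleIso.IsEquivariant {σ : C(D, D)}
    (Ψ : HolomorphicLineBundleIso E L (σ *ᵖ (ConjBundle L))) : Prop :=
  ∀ (h : H) (v : TotalSpace ℂ L), ∃ h' : H, Ψ.lift (h • v) = h' • Ψ.lift v

end Equivariant

end LineBundle

/-! ### Unitary representations -/

section Representation

variable {H : Type*} [Group H] {V : Type*} [NormedAddCommGroup V] [InnerProductSpace ℂ V]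
  [CompleteSpace V]

/-- The ring `End_H(V)` of continuous operators commuting with all `ρ h`. -/
def intertwiningOperators (ρ : H →* unitary (V →L[ℂ] V)) : Subalgebra ℂ (V →L[ℂ] V) :=
  Subalgebra.centralizer ℂ (Set.range fun h => (ρ h : V →L[ℂ] V))

/-- A unitary representation is multiplicity-free if `End_H(V)` is commutative. -/
def IsMultiplicityFree (ρ : H →* unitary (V →L[ℂ] V)) : Prop :=
  ∀ A B : intertwiningOperators ρ, A * B = B * A

end Representation

end

/-! In a trivialization of `L`, evaluation at `x` of the sections `T f` is a bounded functional on
`V`, hence is represented by a vector `κ_x` (`coordVector`), anti-holomorphic in `x`. An element `g`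
of `H` sends `κ_x` to a scalar multiple of `κ_{gx}` (`coordVector_smul`). If `g • x = σ x` and `A`
commutes with `H`, unitarity therefore gives `⟪κ_{σx}, A κ_{σx}⟫ = |c|² ⟪κ_x, A κ_x⟫`, where `c` is
the coordinate of `g : L x → L (σ x)`.

The factor `|c|²` depends on `x` through an uncontrolled choice of `g`, but `Ψ` pins it down: it
equals `|q(x)|²` for a holomorphic function `q` near a given point, a square root of a quotient of
coefficients of `Ψ` (`norm_snd_smul_frame_sq`, `exists_sqrt_coeff_div`). So `k_x = conj (q x) •
κ_x`, anti-holomorphic, and `l_x = κ_{σx}`, holomorphic, have the same diagonal matrix coefficients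
for every intertwining operator (`exists_families`).

A function holomorphic in one variable and anti-holomorphic in another is determined by its
diagonal, whence `⟪l x, A (l y)⟫ = ⟪k y, A (k x)⟫` (`inner_eq_of_inner_self_eq`). For `A = 1` this
says that `k x ↦ l x` extends to an antiunitary `J`, the families being total by injectivity of `T`
and the identity theorem. For general `A` it says `J⁻¹ A J = A*`. The left side preserves the order
of products and the right side reverses it, so intertwining operators commute
(`mul_comm_of_inner_eq`). -/

set_option linter.unusedSectionVars false

/-! ### Antiunitaries and commutation in a Hilbert space -/

section Hilbert

open scoped InnerProductSpace

variable {V : Type*} [NormedAddCommGroup V] [InnerProductSpace ℂ V]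

/-- Two vectors having the same inner products with a total family agree. -/
theorem eq_of_forall_inner_left_eq {ι : Type*} {k : ι → V}
    (hk : ∀ f : V, (∀ i, ⟪k i, f⟫_ℂ = 0) → f = 0) {v w : V}
    (h : ∀ i, ⟪k i, v⟫_ℂ = ⟪k i, w⟫_ℂ) : v = w := by
  rw [← sub_eq_zero]
  exact hk _ fun i => by rw [inner_sub_right, h, sub_self]

theorem dense_range_linearCombination [CompleteSpace V] {ι : Type*} {k : ι → V}
    (hk : ∀ f : V, (∀ i, ⟪k i, f⟫_ℂ = 0) → f = 0) :
    DenseRange (Finsupp.linearCombination ℂ k) := by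
  have h : (Submodule.span ℂ (Set.range k))ᗮ = ⊥ := by
    rw [eq_bot_iff]
    intro f hf
    refine hk f fun i => ?_
    exact (Submodule.mem_orthogonal _ _).1 hf _ (Submodule.subset_span ⟨i, rfl⟩)
  have h2 := (Submodule.topologicalClosure_eq_top_iff).2 h
  rw [← Finsupp.range_linearCombination] at h2
  have h3 := (Submodule.dense_iff_topologicalClosure_eq_top).2 h2
  simpa only [DenseRange, LinearMap.coe_range] using h3

/-- The antiunitary `k i ↦ l i` is handled on coefficient families `a`, by `a ↦ ∑ conj (a i) • l i`,
so that no well-definedness on vectors is needed. Conjugating the coefficients matches the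
conjugate-linear slot on the left with the linear slot on the right. -/
theorem inner_linearCombination_conj {ι : Type*} {k l : ι → V} {A : V →L[ℂ] V}
    (h : ∀ x y, ⟪l x, A (l y)⟫_ℂ = ⟪k y, A (k x)⟫_ℂ) (a : ι →₀ ℂ) (y : ι) :
    ⟪a.sum fun i c => conj c • l i, A (l y)⟫_ℂ =
      ⟪k y, A (Finsupp.linearCombination ℂ k a)⟫_ℂ := by
  simp only [Finsupp.linearCombination_apply, Finsupp.sum, sum_inner, map_sum, inner_sum,
    inner_smul_left, map_smul, inner_smul_right, h, Complex.conj_conj]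

theorem norm_sum_conj_smul {ι : Type*} {k l : ι → V}
    (h : ∀ x y, ⟪l x, l y⟫_ℂ = ⟪k y, k x⟫_ℂ) (a : ι →₀ ℂ) :
    ‖a.sum fun i c => conj c • l i‖ = ‖Finsupp.linearCombination ℂ k a‖ := by
  have h1 : ⟪a.sum fun i c => conj c • l i, a.sum fun i c => conj c • l i⟫_ℂ =
      ⟪Finsupp.linearCombination ℂ k a, Finsupp.linearCombination ℂ k a⟫_ℂ := by
    have h2 := fun y => inner_linearCombination_conj (k := k) (l := l)
      (A := ContinuousLinearMap.id ℂ V) (by simpa using h) a y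
    simp only [ContinuousLinearMap.id_apply] at h2
    conv_lhs => rhs; rw [Finsupp.sum]
    rw [inner_sum]
    conv_rhs => rw [Finsupp.linearCombination_apply, Finsupp.sum, sum_inner]
    refine Finset.sum_congr rfl fun i _ => ?_
    rw [inner_smul_right, inner_smul_left, h2]
    rfl
  rw [inner_self_eq_norm_sq_to_K, inner_self_eq_norm_sq_to_K] at h1
  have h3 : ‖a.sum fun i c => conj c • l i‖ ^ 2 = ‖Finsupp.linearCombination ℂ k a‖ ^ 2 := by
    exact_mod_cast h1
  exact (sq_eq_sq₀ (norm_nonneg _) (norm_nonneg _)).1 h3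

/-- If two total families `k`, `l` satisfy `⟪l x, A l y⟫ = ⟪k y, A k x⟫` for all `A` in a set of
operators closed under products, then the operators in this set commute: the antiunitary `k x ↦ l x`
conjugates each of them into its adjoint. -/
theorem mul_comm_of_inner_eq [CompleteSpace V] {ι : Type*} {k l : ι → V}
    (hk : ∀ f : V, (∀ i, ⟪k i, f⟫_ℂ = 0) → f = 0)
    (hl : ∀ f : V, (∀ i, ⟪l i, f⟫_ℂ = 0) → f = 0) (M : Submonoid (V →L[ℂ] V))
    (h : ∀ A ∈ M, ∀ x y, ⟪l x, A (l y)⟫_ℂ = ⟪k y, A (k x)⟫_ℂ) {A B : V →L[ℂ] V}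
    (hA : A ∈ M) (hB : B ∈ M) : A * B = B * A := by
  have hone : ∀ x y, ⟪l x, l y⟫_ℂ = ⟪k y, k x⟫_ℂ := fun x y => h 1 M.one_mem x y
  suffices H : ∀ x, A (B (k x)) = B (A (k x)) by
    refine ContinuousLinearMap.ext fun v => ?_
    refine congrFun ((dense_range_linearCombination hk).equalizer (A * B).continuous
      (B * A).continuous (funext fun a => ?_)) v
    simp only [Function.comp_apply, Finsupp.linearCombination_apply, Finsupp.sum, map_sum, map_smul,
      mul_apply_eq_comp, H]
  intro x
  obtain ⟨u, hu, hlim⟩ := mem_closure_iff_seq_limit.1 (dense_range_linearCombination hk (B (k x)))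
  choose a ha using hu
  obtain rfl : (fun n => Finsupp.linearCombination ℂ k (a n)) = u := funext ha
  set J : (ι →₀ ℂ) → V := fun a => a.sum fun i c => conj c • l i with hJ
  have hJsub : ∀ a b, J (a - b) = J a - J b := fun a b => by
    simp only [hJ]
    exact Finsupp.sum_sub_index fun i c d => by rw [map_sub, sub_smul]
  have hcauchy : CauchySeq fun n => J (a n) := by
    have h1 := hlim.cauchySeq
    rw [Metric.cauchySeq_iff] at h1 ⊢
    intro ε hε
    obtain ⟨N, hN⟩ := h1 ε hε
    refine ⟨N, fun m hm n hn => ?_⟩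
    have := hN m hm n hn
    rw [dist_eq_norm, ← map_sub, ← norm_sum_conj_smul hone] at this
    rw [dist_eq_norm, ← hJsub]
    exact this
  obtain ⟨p, hp⟩ := cauchySeq_tendsto_of_complete hcauchy
  -- The limit `p` plays the role of `J (B (k x))`; the identity passes to the limit from finite
  -- combinations.
  have key : ∀ C ∈ M, ∀ y, ⟪p, C (l y)⟫_ℂ = ⟪k y, C (B (k x))⟫_ℂ := by
    intro C hC y
    have h1 : Filter.Tendsto (fun n => ⟪J (a n), C (l y)⟫_ℂ) Filter.atTop (𝓝 ⟪p, C (l y)⟫_ℂ) :=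
      hp.inner tendsto_const_nhds
    have h2 : Filter.Tendsto (fun n => ⟪k y, C (Finsupp.linearCombination ℂ k (a n))⟫_ℂ)
        Filter.atTop (𝓝 ⟪k y, C (B (k x))⟫_ℂ) :=
      tendsto_const_nhds.inner ((C.continuous.tendsto _).comp hlim)
    refine tendsto_nhds_unique h1 (h2.congr fun n => ?_)
    exact (inner_linearCombination_conj (h C hC) (a n) y).symm
  -- `C = 1` identifies `p`. Then `C = A`, compared with the hypothesis for the product `B * A`,
  -- gives commutation; `M` need not be closed under adjoints.
  have hp' : p = ContinuousLinearMap.adjoint B (l x) := by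
    refine eq_of_forall_inner_left_eq hl fun y => ?_
    rw [← inner_conj_symm, ← inner_conj_symm (l y)]
    congr 1
    rw [ContinuousLinearMap.adjoint_inner_left, h B hB]
    exact key 1 M.one_mem y
  refine eq_of_forall_inner_left_eq hk fun y => ?_
  rw [← key A hA y, hp', ContinuousLinearMap.adjoint_inner_left]
  exact h (B * A) (M.mul_mem hB hA) x y

/-! ### Weak holomorphy and polarization -/

/-- A locally bounded, weakly holomorphic function of one variable with values in a Hilbert space is
holomorphic. -/
theorem differentiableOn_ball_of_inner [CompleteSpace V] {W : ℂ → V} {R C : ℝ}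
    (hW : ∀ f : V, DifferentiableOn ℂ (fun z => ⟪f, W z⟫_ℂ) (Metric.ball 0 R))
    (hC : ∀ z ∈ Metric.ball (0 : ℂ) R, ‖W z‖ ≤ C) : DifferentiableOn ℂ W (Metric.ball 0 R) := by
  have hcont : ContinuousOn W (Metric.ball 0 R) := by
    intro c hc
    obtain ⟨r, hr, hsub⟩ := Metric.isOpen_iff.1 Metric.isOpen_ball c hc
    refine ContinuousAt.continuousWithinAt ?_
    have hC0 : 0 ≤ C := (norm_nonneg _).trans (hC c hc)
    have hbound : ∀ z ∈ Metric.ball c r, ‖W z - W c‖ ≤ 2 * C / r * dist z c := by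
      intro z hz
      -- Pairing with the increment itself turns the scalar Schwarz estimate into `‖f‖² ≤ ‖f‖ ·
      -- (2C/r) · dist z c`.
      set f := W z - W c with hf
      have hmaps : Set.MapsTo (fun z => ⟪f, W z⟫_ℂ) (Metric.ball c r)
          (Metric.closedBall ⟪f, W c⟫_ℂ (‖f‖ * (2 * C))) := by
        intro v hv
        rw [Metric.mem_closedBall, dist_eq_norm, ← inner_sub_right]
        refine (norm_inner_le_norm _ _).trans ?_
        gcongr
        refine (norm_sub_le _ _).trans ?_
        linarith [hC v (hsub hv), hC c hc]
      have h1 := Complex.dist_le_div_mul_dist_of_mapsTo_ball ((hW f).mono hsub) hmaps hz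
      rw [dist_eq_norm, ← inner_sub_right, ← hf, inner_self_eq_norm_sq_to_K, norm_pow, RCLike.norm_ofReal, abs_norm, sq] at h1
      rcases (norm_nonneg f).eq_or_lt with h0 | h0
      · rw [← h0]; positivity
      · refine le_of_mul_le_mul_left (h1.trans (le_of_eq ?_)) h0
        ring
    rw [ContinuousAt, tendsto_iff_norm_sub_tendsto_zero]
    refine squeeze_zero' (Filter.Eventually.of_forall fun _ => norm_nonneg _)
      (Filter.eventually_of_mem (Metric.ball_mem_nhds c hr) hbound) ?_
    have : Filter.Tendsto (fun z => 2 * C / r * dist z c) (𝓝 c) (𝓝 (2 * C / r * dist c c)) :=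
      (continuous_const.mul (continuous_id.dist continuous_const)).tendsto c
    simpa using this
  intro w hw
  obtain ⟨r, hwr, hrR⟩ := exists_between (Metric.mem_ball.1 hw)
  have hr0 : 0 < r := dist_nonneg.trans_lt hwr
  have hsub : Metric.closedBall (0 : ℂ) r ⊆ Metric.ball 0 R := Metric.closedBall_subset_ball hrR
  lift r to NNReal using hr0.le
  have hr0' : 0 < r := by exact_mod_cast hr0
  have hint : CircleIntegrable W 0 r :=
    (hcont.mono (Metric.sphere_subset_closedBall.trans hsub)).circleIntegrable hr0.le
  have hps := (hasFPowerSeriesOn_cauchy_integral hint hr0').differentiableOn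
  rw [Metric.eball_coe] at hps
  have hwb : w ∈ Metric.ball (0 : ℂ) r := hwr
  -- Cauchy's formula holds after pairing with every `f`, hence in `V`; continuity of `W` is what
  -- makes the vector-valued integral available.
  have heq : ∀ v ∈ Metric.ball (0 : ℂ) r,
      W v = (2 * Real.pi * Complex.I : ℂ)⁻¹ • ∮ z in C(0, r), (z - v)⁻¹ • W z := by
    intro v hv
    refine ext_inner_left ℂ fun f => ?_
    have h1 := ((hW f).mono hsub).diffContOnCl_ball (c := 0) (R := r) (U := Metric.closedBall 0 r) subset_rfl
    have h2 := h1.two_pi_i_inv_smul_circleIntegral_sub_inv_smul hv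
    rw [← h2, inner_smul_right]
    congr 1
    have hint2 : CircleIntegrable (fun z => (z - v)⁻¹ • W z) 0 r := by
      refine ContinuousOn.circleIntegrable hr0.le (ContinuousOn.smul ?_
        (hcont.mono (Metric.sphere_subset_closedBall.trans hsub)))
      refine ContinuousOn.inv₀ (by fun_prop) fun z hz h0 => ?_
      rw [sub_eq_zero] at h0
      subst h0
      rw [Metric.mem_sphere] at hz
      rw [Metric.mem_ball] at hv
      exact hv.ne hz
    have h3 := (innerSL ℂ f).intervalIntegral_comp_comm hint2.out
    simp only [circleIntegral]
    rw [innerSL_apply_apply] at h3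
    rw [← h3]
    refine intervalIntegral.integral_congr fun θ _ => ?_
    simp
  exact ((hps.congr heq).differentiableAt (Metric.isOpen_ball.mem_nhds hwb)).differentiableWithinAt

/-- The conjugation of `z` and the conjugate-linearity of the first slot cancel. -/
theorem differentiableOn_ball_inner_conj {L : ℂ → V} {R : ℝ}
    (hL : DifferentiableOn ℂ L (Metric.ball 0 R)) (A : V →L[ℂ] V) :
    DifferentiableOn ℂ (fun z => ⟪L (conj z), A (L z)⟫_ℂ) (Metric.ball 0 R) := by
  intro z hz
  have hz' : conj z ∈ Metric.ball (0 : ℂ) R := by simpa using hz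
  have h1 : DifferentiableAt ℂ (fun z => innerSL ℂ (L (conj z))) z :=
    DifferentiableAt.comp_semilinear₂ (innerSL ℂ) ((starL ℂ : ℂ ≃L⋆[ℂ] ℂ) : ℂ →L⋆[ℂ] ℂ)
      (hL.differentiableAt (Metric.isOpen_ball.mem_nhds hz'))
  have h2 : DifferentiableAt ℂ (fun z => A (L z)) z :=
    A.differentiableAt.comp z (hL.differentiableAt (Metric.isOpen_ball.mem_nhds hz))
  exact (h1.clm_apply h2).differentiableWithinAt

/-- Polarization in one variable. -/
theorem inner_eq_of_inner_real_eq {L K : ℂ → V}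
    (hL : DifferentiableOn ℂ L (Metric.ball 0 2)) (hK : DifferentiableOn ℂ K (Metric.ball 0 2))
    (A : V →L[ℂ] V)
    (h : ∀ t : ℝ, (t : ℂ) ∈ Metric.ball (0 : ℂ) 2 → ⟪L t, A (L t)⟫_ℂ = ⟪K t, A (K t)⟫_ℂ) :
    ⟪L (-Complex.I), A (L Complex.I)⟫_ℂ = ⟪K (-Complex.I), A (K Complex.I)⟫_ℂ := by
  have h1 := (differentiableOn_ball_inner_conj hL A).analyticOnNhd Metric.isOpen_ball
  have h2 := (differentiableOn_ball_inner_conj hK A).analyticOnNhd Metric.isOpen_ball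
  -- On the real axis `conj z = z`, so the hypothesis applies there, and the real axis accumulates
  -- at `0`. The identity theorem then reaches `z = I`.
  have hfreq : ∃ᶠ z in 𝓝[≠] (0 : ℂ), ⟪L (conj z), A (L z)⟫_ℂ = ⟪K (conj z), A (K z)⟫_ℂ := by
    have hlim : Filter.Tendsto (fun t : ℝ => (t : ℂ)) (𝓝[≠] 0) (𝓝[≠] 0) := by
      refine tendsto_nhdsWithin_iff.2 ⟨?_, ?_⟩
      · exact (Complex.continuous_ofReal.tendsto' 0 0 (by simp)).mono_left nhdsWithin_le_nhds
      · filter_upwards [self_mem_nhdsWithin] with t ht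
        simpa using ht
    refine hlim.frequently (Filter.Eventually.frequently ?_)
    have h3 : ∀ᶠ t : ℝ in 𝓝 0, (t : ℂ) ∈ Metric.ball (0 : ℂ) 2 :=
      Complex.continuous_ofReal.continuousAt.eventually
        (Metric.isOpen_ball.mem_nhds (by simp))
    filter_upwards [nhdsWithin_le_nhds h3] with t ht
    simpa using h t ht
  have h3 := h1.eqOn_of_preconnected_of_frequently_eq h2
    (convex_ball (0 : ℂ) 2).isPreconnected (by simp) hfreq (x := Complex.I) (by simp)
  simpa using h3

variable {E : Type*} [NormedAddCommGroup E] [NormedSpace ℂ E]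

/-- Polarization on a ball: if `l` is weakly holomorphic, `k` is weakly anti-holomorphic, and
`⟪l z, A l z⟫ = ⟪k z, A k z⟫` for all `z`, then `⟪l x, A l y⟫ = ⟪k y, A k x⟫`. -/
theorem inner_eq_of_inner_self_eq [CompleteSpace V] {k l : E → V} {z₀ : E} {r C : ℝ}
    (hk : ∀ f : V, DifferentiableOn ℂ (fun z => ⟪k z, f⟫_ℂ) (Metric.ball z₀ (3 * r)))
    (hl : ∀ f : V, DifferentiableOn ℂ (fun z => ⟪f, l z⟫_ℂ) (Metric.ball z₀ (3 * r)))
    (hkC : ∀ z ∈ Metric.ball z₀ (3 * r), ‖k z‖ ≤ C)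
    (hlC : ∀ z ∈ Metric.ball z₀ (3 * r), ‖l z‖ ≤ C) (A : V →L[ℂ] V)
    (h : ∀ z ∈ Metric.ball z₀ (3 * r), ⟪l z, A (l z)⟫_ℂ = ⟪k z, A (k z)⟫_ℂ)
    {x y : E} (hx : x ∈ Metric.ball z₀ r) (hy : y ∈ Metric.ball z₀ r) :
    ⟪l x, A (l y)⟫_ℂ = ⟪k y, A (k x)⟫_ℂ := by
  -- The complex line `p z = m + z • d` has `p I = y` and `p (-I) = x`. Since `m` is within `r` of
  -- `z₀` and `‖d‖ < r`, the disc of radius `2`, which contains `±I`, is mapped into the ball of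
  -- radius `3 * r`.
  set m : E := (2⁻¹ : ℂ) • (x + y)
  set d : E := (2 * Complex.I)⁻¹ • (y - x)
  have hI : Complex.I * (2 * Complex.I)⁻¹ = 2⁻¹ := by field_simp
  set p : ℂ → E := fun z => m + z • d
  have hpI : p Complex.I = y := by
    simp only [p, m, d, smul_smul, hI]
    module
  have hpI' : p (-Complex.I) = x := by
    simp only [p, m, d, smul_smul, neg_mul, hI]
    module
  have hm : ‖m - z₀‖ < r := by
    have : m - z₀ = (2⁻¹ : ℂ) • ((x - z₀) + (y - z₀)) := by simp only [m]; module
    rw [mem_ball_iff_norm] at hx hy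
    rw [this, norm_smul]
    have := norm_add_le (x - z₀) (y - z₀)
    norm_num
    linarith
  have hd : ‖d‖ < r := by
    rw [mem_ball_iff_norm] at hx hy
    simp only [d]
    rw [norm_smul]
    have := norm_sub_le (y - z₀) (x - z₀)
    rw [sub_sub_sub_cancel_right] at this
    norm_num
    linarith
  have hp : Set.MapsTo p (Metric.ball 0 2) (Metric.ball z₀ (3 * r)) := by
    intro z hz
    rw [mem_ball_zero_iff] at hz
    rw [mem_ball_iff_norm]
    have : p z - z₀ = (m - z₀) + z • d := by simp only [p]; abel
    rw [this]
    refine (norm_add_le _ _).trans_lt ?_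
    rw [norm_smul]
    nlinarith [norm_nonneg d, norm_nonneg z]
  have hpd : Differentiable ℂ p := by fun_prop
  have hconj : ∀ z ∈ Metric.ball (0 : ℂ) 2, conj z ∈ Metric.ball (0 : ℂ) 2 := by simp
  have hL : DifferentiableOn ℂ (fun z => l (p z)) (Metric.ball 0 2) :=
    differentiableOn_ball_of_inner (fun f => (hl f).comp hpd.differentiableOn hp)
      fun z hz => hlC _ (hp hz)
  -- Precomposing with `conj` makes `k` holomorphic along the line and exchanges `x` and `y`.
  have hK : DifferentiableOn ℂ (fun z => k (p (conj z))) (Metric.ball 0 2) := by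
    refine differentiableOn_ball_of_inner (fun f z hz => ?_) fun z hz => hkC _ (hp (hconj z hz))
    have h1 := ((hk f).comp hpd.differentiableOn hp).differentiableAt
      (Metric.isOpen_ball.mem_nhds (hconj z hz))
    have h2 := h1.conj_conj
    rw [Complex.conj_conj] at h2
    refine DifferentiableAt.differentiableWithinAt (h2.congr_of_eventuallyEq
      (Filter.Eventually.of_forall fun w => ?_))
    exact (inner_conj_symm _ _).symm
  have := inner_eq_of_inner_real_eq hL hK A fun t ht => by
    simpa using h _ (hp ht)
  simpa [hpI, hpI'] using this

end Hilbert

/-- Division by `w₀` moves the base point to `1`, away from the cut of the logarithm. -/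
theorem exists_holomorphic_sqrt {w₀ : ℂ} (hw₀ : w₀ ≠ 0) :
    ∃ S : ℂ → ℂ, ∀ᶠ w in 𝓝 w₀, DifferentiableAt ℂ S w ∧ S w ^ 2 = w := by
  obtain ⟨s, hs⟩ := IsAlgClosed.exists_pow_nat_eq w₀ (n := 2) two_pos
  refine ⟨fun w => s * Complex.exp (Complex.log (w / w₀) / 2), ?_⟩
  have h1 : ∀ᶠ w in 𝓝 w₀, w / w₀ ∈ Complex.slitPlane := by
    refine (continuous_id.div_const w₀).continuousAt.eventually
      (Complex.isOpen_slitPlane.mem_nhds ?_)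
    simp [hw₀]
  filter_upwards [h1] with w hw
  refine ⟨?_, ?_⟩
  · have h2 : DifferentiableAt ℂ (fun w => Complex.log (w / w₀)) w :=
      (differentiableAt_id.div_const w₀).clog hw
    exact (h2.div_const 2).cexp.const_mul s
  · rw [mul_pow, hs, ← Complex.exp_nat_mul]
    have h3 : ((2 : ℕ) : ℂ) * (Complex.log (w / w₀) / 2) = Complex.log (w / w₀) := by
      push_cast; ring
    rw [h3, Complex.exp_log (Complex.slitPlane_ne_zero hw)]
    field_simp

/-! ### Anti-holomorphic maps and holomorphic functions in charts -/

section Manifold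

variable {E : Type*} [NormedAddCommGroup E] [NormedSpace ℂ E]
  {D : Type*} [TopologicalSpace D] [ChartedSpace E D]

/-- Composing a holomorphic function with an anti-holomorphic map and complex conjugation gives a
holomorphic function. -/
theorem IsAntiholomorphic.mdifferentiableAt_conj_comp {σ : D → D} (hσ : IsAntiholomorphic E σ)
    {g : D → ℂ} {x : D} (hg : MDifferentiableAt 𝓘(ℂ, E) 𝓘(ℂ, ℂ) g (σ x)) :
    MDifferentiableAt 𝓘(ℂ, E) 𝓘(ℂ, ℂ) (fun y => conj (g (σ y))) x := by
  have hσx : MDifferentiableAt 𝓘(ℝ, E) 𝓘(ℝ, E) σ x :=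
    hσ.contMDiff.mdifferentiableAt (by simp)
  have hcont : ContinuousAt (fun y => conj (g (σ y))) x :=
    Complex.continuous_conj.continuousAt.comp (hg.continuousAt.comp hσx.continuousAt)
  set φ := chartAt E x
  set ψ := chartAt E (σ x)
  have hφx : x ∈ φ.source := mem_chart_source E x
  set τ : E → E := fun z => ψ (σ (φ.symm z)) with hτ
  have hτx : τ (φ x) = ψ (σ x) := by rw [hτ]; simp only [φ.left_inv hφx]
  have h1 : DifferentiableAt ℝ τ (φ x) := by
    refine differentiableWithinAt_univ.1 ?_
    simpa [writtenInExtChartAt, Function.comp_def] using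
      hσx.differentiableWithinAt_writtenInExtChartAt
  have h2 : DifferentiableAt ℂ (fun z => g (ψ.symm z)) (τ (φ x)) := by
    rw [hτx]
    have h := hg.differentiableWithinAt_writtenInExtChartAt
    rw [modelWithCornersSelf_coe, Set.range_id, differentiableWithinAt_univ] at h
    exact h
  have h3 : ∀ (c : ℂ) (v : E), fderiv ℝ τ (φ x) (c • v) = conj c • fderiv ℝ τ (φ x) v := by
    intro c v
    have h4 : (show E →L[ℝ] E from mfderiv 𝓘(ℝ, E) 𝓘(ℝ, E) σ x) = fderiv ℝ τ (φ x) := by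
      refine hσx.mfderiv.trans ?_
      simp [writtenInExtChartAt, Function.comp_def, hτ, φ, ψ]
      rfl
    have h5 := hσ.mfderiv_conj x c v
    rwa [h4] at h5
  -- The real derivative is `conj ∘ Dg ∘ Dτ`; its two conjugate-linear factors make it complex
  -- linear.
  have h4 : DifferentiableAt ℂ (fun z => conj (g (ψ.symm (τ z)))) (φ x) := by
    have h5 := Complex.conjCLE.hasFDerivAt.comp (φ x)
      ((h2.hasFDerivAt.restrictScalars ℝ).comp (φ x) h1.hasFDerivAt)
    refine (differentiableAt_iff_restrictScalars ℝ h5.differentiableAt).2 ⟨⟨⟨⟨fun v =>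
      conj (fderiv ℂ (fun z => g (ψ.symm z)) (τ (φ x)) (fderiv ℝ τ (φ x) v)), ?_⟩, ?_⟩, ?_⟩, ?_⟩
    · intro v w
      simp only [map_add]
    · intro c v
      simp only [h3, map_smul, smul_eq_mul, map_mul, Complex.conj_conj, RingHom.id_apply]
    · exact Complex.continuous_conj.comp ((ContinuousLinearMap.continuous _).comp
        (ContinuousLinearMap.continuous _))
    · rw [h5.fderiv]
      rfl
  refine (mdifferentiableAt_iff _ _).2 ⟨hcont, ?_⟩
  have h5 : DifferentiableAt ℂ (fun z => conj (g (σ (φ.symm z)))) (φ x) := by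
    refine h4.congr_of_eventuallyEq ?_
    have h6 : ContinuousAt (fun z => σ (φ.symm z)) (φ x) := by
      refine ContinuousAt.comp ?_ (φ.continuousAt_symm (φ.map_source hφx))
      rw [φ.left_inv hφx]
      exact hσx.continuousAt
    have h7 : ∀ᶠ z in 𝓝 (φ x), σ (φ.symm z) ∈ ψ.source := by
      refine h6.eventually (ψ.open_source.mem_nhds ?_)
      simp only [φ.left_inv hφx]
      exact mem_chart_source E (σ x)
    filter_upwards [h7] with z hz
    rw [hτ]
    simp only [ψ.left_inv hz]
  rw [modelWithCornersSelf_coe, Set.range_id, differentiableWithinAt_univ]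
  exact h5

variable [IsManifold 𝓘(ℂ, E) ω D]

theorem MDifferentiableAt.differentiableAt_comp_chart_symm {f : D → ℂ} {x₀ : D} {z : E}
    (hz : z ∈ (chartAt E x₀).target)
    (hf : MDifferentiableAt 𝓘(ℂ, E) 𝓘(ℂ, ℂ) f ((chartAt E x₀).symm z)) :
    DifferentiableAt ℂ (fun z => f ((chartAt E x₀).symm z)) z := by
  rw [← mdifferentiableAt_iff_differentiableAt]
  exact hf.comp z (mdifferentiableAt_atlas_symm (chart_mem_atlas E x₀) hz)

/-! ### Holomorphic sections and the vectors representing evaluation -/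

section Sections

variable {L : D → Type*} [∀ x, AddCommGroup (L x)] [∀ x, Module ℂ (L x)]
    [TopologicalSpace (TotalSpace ℂ L)] [∀ x, TopologicalSpace (L x)] [FiberBundle ℂ L]
    [VectorBundle ℂ ℂ L] [ContMDiffVectorBundle ω ℂ L 𝓘(ℂ, E)]

theorem HolomorphicSection.contMDiffOn_coord (s : HolomorphicSection E L)
    (e : Trivialization ℂ (π ℂ L)) [MemTrivializationAtlas e] :
    ContMDiffOn 𝓘(ℂ, E) 𝓘(ℂ, ℂ) ω (fun x => (e ⟨x, s x⟩).2) e.baseSet :=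
  (e.contMDiffOn_section_baseSet_iff (IB := 𝓘(ℂ, E)) (n := ω)).1 s.contMDiff.contMDiffOn

theorem Bundle.Trivialization.snd_eq_zero_iff_of_mem (e : Trivialization ℂ (π ℂ L))
    [MemTrivializationAtlas e] {x : D} (hx : x ∈ e.baseSet) (v : L x) :
    (e ⟨x, v⟩).2 = 0 ↔ v = 0 := by
  have h := (e.linearEquivAt ℂ x hx).map_eq_zero_iff (x := v)
  exact h

/-- The identity theorem for holomorphic sections. -/
theorem HolomorphicSection.eq_zero_of_eventually_eq_zero [ConnectedSpace D]
    (s : HolomorphicSection E L) {x₀ : D} (h : ∀ᶠ x in 𝓝 x₀, s x = 0) : s = 0 := by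
  -- For closedness: around a point of the closure, a chart ball on which the coordinate of `s` is
  -- analytic contains a point near which `s` vanishes, so `s` vanishes on the whole ball.
  have hclopen : IsClopen {x | ∀ᶠ y in 𝓝 x, s y = 0} := by
    refine ⟨isClosed_of_closure_subset fun x₁ hx₁ => ?_, isOpen_setOfPred_eventually_nhds⟩
    set e := trivializationAt ℂ L x₁
    set φ := chartAt E x₁
    have hφx₁ : x₁ ∈ φ.source := mem_chart_source E x₁
    have hU : φ.target ∩ φ.symm ⁻¹' e.baseSet ∈ 𝓝 (φ x₁) :=
      (φ.isOpen_inter_preimage_symm e.open_baseSet).mem_nhds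
        ⟨φ.map_source hφx₁, by
          rw [Set.mem_preimage, φ.left_inv hφx₁]; exact mem_baseSet_trivializationAt ℂ L x₁⟩
    obtain ⟨r, hr, hball⟩ := Metric.mem_nhds_iff.1 hU
    set F : E → ℂ := fun z => (e ⟨φ.symm z, s (φ.symm z)⟩).2
    have hF : AnalyticOnNhd ℂ F (Metric.ball (φ x₁) r) := by
      have h1 : ContMDiffOn 𝓘(ℂ, E) 𝓘(ℂ, ℂ) ω F (Metric.ball (φ x₁) r) :=
        (s.contMDiffOn_coord e).comp
          ((contMDiffOn_chart_symm (I := 𝓘(ℂ, E)) (n := ω) (x := x₁)).mono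
            fun z hz => (hball hz).1) fun z hz => (hball hz).2
      exact (Metric.isOpen_ball.analyticOn_iff_analyticOnNhd).1
        (contMDiffOn_iff_contDiffOn.1 h1).analyticOn
    have hN : φ.source ∩ φ ⁻¹' Metric.ball (φ x₁) r ∈ 𝓝 x₁ :=
      Filter.inter_mem (φ.open_source.mem_nhds hφx₁)
        ((φ.continuousAt hφx₁).preimage_mem_nhds (Metric.ball_mem_nhds _ hr))
    obtain ⟨x₂, ⟨hx₂s, hx₂b⟩, hx₂⟩ := mem_closure_iff_nhds.1 hx₁ _ hN
    have hzero : F =ᶠ[𝓝 (φ x₂)] 0 := by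
      have h2 : ∀ᶠ z in 𝓝 (φ x₂), s (φ.symm z) = 0 :=
        (φ.tendsto_symm hx₂s).eventually hx₂
      filter_upwards [h2, Metric.isOpen_ball.mem_nhds hx₂b] with z hz hzb
      exact (e.snd_eq_zero_iff_of_mem (hball hzb).2 _).2 hz
    have hEq := hF.eqOn_zero_of_preconnected_of_eventuallyEq_zero
      (convex_ball _ _).isPreconnected hx₂b hzero
    filter_upwards [hN] with y hy
    have h3 : F (φ y) = 0 := hEq hy.2
    have h4 := (e.snd_eq_zero_iff_of_mem (hball hy.2).2 _).1 h3
    rwa [φ.left_inv hy.1] at h4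
  have huniv := hclopen.eq_univ ⟨x₀, h⟩
  ext x
  have : x ∈ {x | ∀ᶠ y in 𝓝 x, s y = 0} := huniv ▸ Set.mem_univ x
  exact this.self_of_nhds

variable {V : Type*} [NormedAddCommGroup V] [InnerProductSpace ℂ V]

/-- The functional taking `f` to the coordinate of the section `T f` at `x` in the trivialization
`e`. -/
noncomputable def evalCoord (T : V →L[ℂ] HolomorphicSection E L) (e : Trivialization ℂ (π ℂ L))
    [MemTrivializationAtlas e] (x : D) : V →ₗ[ℂ] ℂ where
  toFun f := e.linearMapAt ℂ x (T f x)
  map_add' f g := by rw [map_add, ContMDiffSection.coe_add, Pi.add_apply, map_add]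
  map_smul' c f := by
    rw [map_smul, ContMDiffSection.coe_smul, Pi.smul_apply, map_smul, RingHom.id_apply]

variable (T : V →L[ℂ] HolomorphicSection E L) (e : Trivialization ℂ (π ℂ L))
    [MemTrivializationAtlas e]

theorem evalCoord_apply {x : D} (hx : x ∈ e.baseSet) (f : V) :
    evalCoord T e x f = (e ⟨x, T f x⟩).2 := by
  change e.linearMapAt ℂ x (T f x) = _
  rw [e.coe_linearMapAt_of_mem hx]

theorem contMDiffOn_evalCoord (f : V) :
    ContMDiffOn 𝓘(ℂ, E) 𝓘(ℂ, ℂ) ω (fun x => evalCoord T e x f) e.baseSet :=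
  ((T f).contMDiffOn_coord e).congr fun _ hx => evalCoord_apply T e hx f

theorem mdifferentiableAt_evalCoord (f : V) {x : D} (hx : x ∈ e.baseSet) :
    MDifferentiableAt 𝓘(ℂ, E) 𝓘(ℂ, ℂ) (fun x => evalCoord T e x f) x :=
  ((contMDiffOn_evalCoord T e f).contMDiffAt (e.open_baseSet.mem_nhds hx)).mdifferentiableAt
    (by simp)

variable [FiniteDimensional ℂ E]

/-- `D` is locally compact because `E` is finite-dimensional, and over such a space evaluation is
jointly continuous for the compact-open topology. -/
theorem continuous_totalSpace_eval :
    Continuous fun p : V × D => (⟨p.2, T p.1 p.2⟩ : TotalSpace ℂ L) := by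
  have : ProperSpace E := FiniteDimensional.proper ℂ E
  have : LocallyCompactSpace D := ChartedSpace.locallyCompactSpace E D
  have h : Continuous fun f : V => HolomorphicSection.toContinuousMap (T f) :=
    continuous_induced_dom.comp T.continuous
  exact (h.comp continuous_fst).eval continuous_snd

/-- Joint continuity at `(0, x₀)` bounds the coordinate by `1` on a `δ`-ball of `V`, uniformly for
`x` near `x₀`; homogeneity gives the constant `1 / δ`. -/
theorem exists_norm_evalCoord_le {x₀ : D} (hx₀ : x₀ ∈ e.baseSet) :
    ∃ C : ℝ, 0 ≤ C ∧ ∀ᶠ x in 𝓝 x₀, ∀ f : V, ‖evalCoord T e x f‖ ≤ C * ‖f‖ := by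
  have h1 : ContinuousAt (fun p : V × D => (e ⟨p.2, T p.1 p.2⟩).2) (0, x₀) := by
    have h2 : ContinuousAt e (⟨x₀, T 0 x₀⟩ : TotalSpace ℂ L) :=
      e.continuousAt (e.mem_source.2 hx₀)
    exact (ContinuousAt.comp (f := fun p : V × D => (⟨p.2, T p.1 p.2⟩ : TotalSpace ℂ L)) h2
      (continuous_totalSpace_eval T).continuousAt).snd
  have h0 : (e ⟨x₀, T 0 x₀⟩).2 = 0 := by rw [← evalCoord_apply T e hx₀, map_zero]
  have h3 : ∀ᶠ p : V × D in 𝓝 (0, x₀), ‖(e ⟨p.2, T p.1 p.2⟩).2‖ ≤ 1 := by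
    have := h1.norm.eventually (eventually_le_nhds (b := 1) (by simp only [h0, norm_zero, one_pos]))
    exact this
  rw [nhds_prod_eq] at h3
  obtain ⟨P, hP, Q, hQ, hPQ⟩ := Filter.eventually_prod_iff.1 h3
  obtain ⟨δ, hδ, hball⟩ := Metric.nhds_basis_closedBall.mem_iff.1 hP
  refine ⟨1 / δ, by positivity, ?_⟩
  filter_upwards [hQ, e.open_baseSet.mem_nhds hx₀] with x hx hxe f
  refine LinearMap.bound_of_ball_bound' hδ 1 (evalCoord T e x) (fun g hg => ?_) f
  rw [evalCoord_apply T e hxe]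
  exact hPQ (hball hg) hx

theorem continuous_evalCoord (x : D) : Continuous (evalCoord T e x) := by
  by_cases hx : x ∈ e.baseSet
  · obtain ⟨C, hC0, hC⟩ := exists_norm_evalCoord_le T e hx
    exact AddMonoidHomClass.continuous_of_bound _ C hC.self_of_nhds
  -- Off the base set, `linearMapAt` takes the default value `0`.
  · have : ∀ f, evalCoord T e x f = 0 := fun f => by
      change e.linearMapAt ℂ x (T f x) = _
      rw [e.linearMapAt_def_of_notMem hx, LinearMap.zero_apply]
    exact continuous_const.congr fun f => (this f).symm

open scoped InnerProductSpace

variable [CompleteSpace V]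

/-- The vector representing `evalCoord T e x`. -/
noncomputable def coordVector (x : D) : V :=
  (InnerProductSpace.toDual ℂ V).symm ⟨evalCoord T e x, continuous_evalCoord T e x⟩

theorem inner_coordVector (x : D) (f : V) : ⟪coordVector T e x, f⟫_ℂ = evalCoord T e x f := by
  rw [coordVector, InnerProductSpace.toDual_symm_apply]
  rfl

theorem exists_norm_coordVector_le {x₀ : D} (hx₀ : x₀ ∈ e.baseSet) :
    ∃ C : ℝ, ∀ᶠ x in 𝓝 x₀, ‖coordVector T e x‖ ≤ C := by
  obtain ⟨C, hC0, hC⟩ := exists_norm_evalCoord_le T e hx₀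
  refine ⟨C, hC.mono fun x hx => ?_⟩
  have h := hx (coordVector T e x)
  rw [← inner_coordVector, inner_self_eq_norm_sq_to_K, norm_pow, RCLike.norm_ofReal, abs_norm,
    sq] at h
  rcases (norm_nonneg (coordVector T e x)).eq_or_lt with h0 | h0
  · rwa [← h0]
  · exact le_of_mul_le_mul_right h h0

end Sections

end Manifold

/-! ### Frames, the group action and the coefficients of `Ψ` -/

section LineBundle

variable {E : Type*} [NormedAddCommGroup E] [NormedSpace ℂ E]
  {D : Type*} [TopologicalSpace D] [ChartedSpace E D]
  {L : D → Type*} [∀ x, AddCommGroup (L x)] [∀ x, Module ℂ (L x)]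
  [TopologicalSpace (TotalSpace ℂ L)] [∀ x, TopologicalSpace (L x)] [FiberBundle ℂ L]

/-- The local frame of a line bundle given by a trivialization. -/
noncomputable def Bundle.Trivialization.frame (e : Trivialization ℂ (π ℂ L)) (x : D) :
    TotalSpace ℂ L := ⟨x, e.symm x 1⟩

@[simp] theorem Bundle.Trivialization.frame_proj (e : Trivialization ℂ (π ℂ L)) (x : D) :
    (e.frame x).proj = x := rfl

theorem Bundle.Trivialization.apply_frame (e : Trivialization ℂ (π ℂ L)) {x : D}
    (hx : x ∈ e.baseSet) : e (e.frame x) = (x, 1) := e.apply_mk_symm hx 1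

section Coord

variable [VectorBundle ℂ ℂ L] (e : Trivialization ℂ (π ℂ L)) [MemTrivializationAtlas e]

theorem Bundle.Trivialization.snd_smul {x : D} (hx : x ∈ e.baseSet) (c : ℂ) (v : L x) :
    (e ⟨x, c • v⟩).2 = c * (e ⟨x, v⟩).2 :=
  (e.linear ℂ hx).map_smul c v

theorem Bundle.Trivialization.eq_snd_smul_symm {x : D} (hx : x ∈ e.baseSet) (v : L x) :
    v = (e ⟨x, v⟩).2 • e.symm x 1 := by
  have h : (e.linearEquivAt ℂ x hx) v = (e.linearEquivAt ℂ x hx) ((e ⟨x, v⟩).2 • e.symm x 1) := by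
    change (e ⟨x, v⟩).2 = (e ⟨x, (e ⟨x, v⟩).2 • e.symm x 1⟩).2
    rw [e.snd_smul hx, e.apply_mk_symm hx, mul_one]
  exact (e.linearEquivAt ℂ x hx).injective h

theorem snd_smul_eq_mul {EH : Type*} [NormedAddCommGroup EH] [NormedSpace ℝ EH]
    {H : Type*} [Group H] [TopologicalSpace H] [ChartedSpace EH H] [MulAction H D]
    [MulAction H (TotalSpace ℂ L)] (hL : IsEquivariantHolomorphicLineBundle E EH H L)
    (e' : Trivialization ℂ (π ℂ L)) [MemTrivializationAtlas e'] (h : H) {p : TotalSpace ℂ L}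
    (hp : p.proj ∈ e.baseSet) (hhp : h • p.proj ∈ e'.baseSet) :
    (e' (h • p)).2 = (e p).2 * (e' (h • e.frame p.proj)).2 := by
  obtain ⟨x, v⟩ := p
  obtain ⟨ℓ, hℓ⟩ := hL.fiber_linear h x
  conv_lhs => rw [e.eq_snd_smul_symm hp v]
  rw [hℓ, map_smul, e'.snd_smul hhp, Bundle.Trivialization.frame, hℓ]

theorem proj_smul {EH : Type*} [NormedAddCommGroup EH] [NormedSpace ℝ EH]
    {H : Type*} [Group H] [TopologicalSpace H] [ChartedSpace EH H] [MulAction H D]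
    [MulAction H (TotalSpace ℂ L)] (hL : IsEquivariantHolomorphicLineBundle E EH H L)
    (h : H) (p : TotalSpace ℂ L) : (h • p).proj = h • p.proj := by
  obtain ⟨ℓ, hℓ⟩ := hL.fiber_linear h p.proj
  exact congrArg TotalSpace.proj (hℓ p.2)

end Coord

section Lift

variable {σ : C(D, D)} (Ψ : HolomorphicLineBundleIso E L (σ *ᵖ (ConjBundle L)))

/-- The coefficient of `Ψ` in the frames given by the trivializations `e`, `e'`. -/
noncomputable def HolomorphicLineBundleIso.coeff (e e' : Trivialization ℂ (π ℂ L)) (x : D) : ℂ :=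
  (e' (Ψ.lift (e.frame x))).2

theorem HolomorphicLineBundleIso.snd_lift [VectorBundle ℂ ℂ L] (e e' : Trivialization ℂ (π ℂ L))
    [MemTrivializationAtlas e] [MemTrivializationAtlas e'] {p : TotalSpace ℂ L}
    (hp : p.proj ∈ e.baseSet) (hσp : σ p.proj ∈ e'.baseSet) :
    (e' (Ψ.lift p)).2 = conj (e p).2 * Ψ.coeff e e' p.proj := by
  obtain ⟨x, v⟩ := p
  have h1 : Ψ.fiberEquiv x v = (e ⟨x, v⟩).2 • Ψ.fiberEquiv x (e.symm x 1) := by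
    rw [← map_smul, ← e.eq_snd_smul_symm hp v]
  have h2 : (Ψ.lift ⟨x, v⟩ : TotalSpace ℂ L) = ⟨σ x, (conj (e ⟨x, v⟩).2 •
      (show L (σ x) from Ψ.fiberEquiv x (e.symm x 1)) : L (σ x))⟩ :=
    congrArg (TotalSpace.mk (F := ℂ) (E := L) (σ x)) h1
  rw [h2, e'.snd_smul hσp]
  rfl

theorem HolomorphicLineBundleIso.coeff_ne_zero [VectorBundle ℂ ℂ L]
    (e e' : Trivialization ℂ (π ℂ L)) [MemTrivializationAtlas e] [MemTrivializationAtlas e']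
    {x : D} (hx : x ∈ e.baseSet) (hσx : σ x ∈ e'.baseSet) : Ψ.coeff e e' x ≠ 0 := by
  intro h
  have h1 : (e' ⟨σ x, (show L (σ x) from Ψ.fiberEquiv x (e.symm x 1))⟩).2 = 0 := h
  have h2 := (e'.linearEquivAt ℂ (σ x) hσx).map_eq_zero_iff.1 h1
  have h3 : e.symm x 1 = 0 := (Ψ.fiberEquiv x).map_eq_zero_iff.1 h2
  have h4 := e.apply_mk_symm hx (1 : ℂ)
  have h5 : (e ⟨x, (0 : ℂ) • e.symm x 1⟩).2 = 1 := by
    rw [zero_smul, ← h3, h4]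
  rw [e.snd_smul hx, zero_mul] at h5
  exact zero_ne_one h5

/-- Trivializations of the conjugate bundle are conjugates of those of `L`, so the coordinate of the
holomorphic section `Ψ ∘ e.frame` is the conjugate of the coefficient. The second trivialization is
the one at `σ x₀` because it induces the preferred one of the pull-back at `x₀`. -/
theorem HolomorphicLineBundleIso.contMDiffAt_conj_coeff [IsManifold 𝓘(ℂ, E) ω D]
    [VectorBundle ℂ ℂ L] [ContMDiffVectorBundle ω ℂ L 𝓘(ℂ, E)] (e : Trivialization ℂ (π ℂ L))
    [MemTrivializationAtlas e] {x₀ : D} (hx₀ : x₀ ∈ e.baseSet) :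
    ContMDiffAt 𝓘(ℂ, E) 𝓘(ℂ, ℂ) ω
      (fun x => conj (Ψ.coeff e (trivializationAt ℂ L (σ x₀)) x)) x₀ := by
  have h1 : ContMDiffAt 𝓘(ℂ, E) (𝓘(ℂ, E).prod 𝓘(ℂ, ℂ)) ω e.frame x₀ := by
    refine (e.contMDiffAt_section_iff hx₀).2 ?_
    refine (contMDiffAt_const (c := (1 : ℂ))).congr_of_eventuallyEq ?_
    filter_upwards [e.open_baseSet.mem_nhds hx₀] with x hx
    exact congrArg Prod.snd (e.apply_frame hx)
  have h2 := Ψ.holomorphic.contMDiffAt.comp x₀ h1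
  exact (contMDiffAt_totalSpace.1 h2).2

theorem HolomorphicLineBundleIso.eventually_mdifferentiableAt_conj_coeff
    [IsManifold 𝓘(ℂ, E) ω D] [VectorBundle ℂ ℂ L] [ContMDiffVectorBundle ω ℂ L 𝓘(ℂ, E)]
    (e : Trivialization ℂ (π ℂ L)) [MemTrivializationAtlas e] {x₀ : D} (hx₀ : x₀ ∈ e.baseSet) :
    ∀ᶠ x in 𝓝 x₀, MDifferentiableAt 𝓘(ℂ, E) 𝓘(ℂ, ℂ)
      (fun x => conj (Ψ.coeff e (trivializationAt ℂ L (σ x₀)) x)) x :=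
  ((contMDiffAt_iff_contMDiffAt_nhds (by simp)).1 (Ψ.contMDiffAt_conj_coeff e hx₀)).mono
    fun _ hx => hx.mdifferentiableAt (by simp)

/-- A holomorphic square root, near `x₀`, of the ratio of the coefficients of `Ψ` at `x` and at
`σ x`. -/
theorem HolomorphicLineBundleIso.exists_sqrt_coeff_div [IsManifold 𝓘(ℂ, E) ω D]
    [VectorBundle ℂ ℂ L] [ContMDiffVectorBundle ω ℂ L 𝓘(ℂ, E)] (hσ : IsAntiholomorphic E σ)
    (hσ_inv : Function.Involutive σ) (x₀ : D) :
    ∃ q : D → ℂ, ∀ᶠ x in 𝓝 x₀, MDifferentiableAt 𝓘(ℂ, E) 𝓘(ℂ, ℂ) q x ∧ q x ≠ 0 ∧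
      q x ^ 2 = conj (Ψ.coeff (trivializationAt ℂ L x₀) (trivializationAt ℂ L (σ x₀)) x) /
        Ψ.coeff (trivializationAt ℂ L (σ x₀)) (trivializationAt ℂ L x₀) (σ x) := by
  set e := trivializationAt ℂ L x₀
  set e' := trivializationAt ℂ L (σ x₀)
  have hx₀ : x₀ ∈ e.baseSet := mem_baseSet_trivializationAt ℂ L x₀
  have hσx₀ : σ x₀ ∈ e'.baseSet := mem_baseSet_trivializationAt ℂ L (σ x₀)
  have h1 := Ψ.eventually_mdifferentiableAt_conj_coeff e hx₀
  have h2 := Ψ.eventually_mdifferentiableAt_conj_coeff e' hσx₀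
  rw [hσ_inv x₀] at h2
  -- The coefficient at `σ x` is anti-holomorphic in `σ x`, hence holomorphic in `x`.
  have h3 : ∀ᶠ x in 𝓝 x₀, MDifferentiableAt 𝓘(ℂ, E) 𝓘(ℂ, ℂ)
      (fun x => Ψ.coeff e' e (σ x)) x := by
    filter_upwards [σ.continuous.continuousAt.eventually h2] with x hx
    simpa using hσ.mdifferentiableAt_conj_comp hx
  have hbase : ∀ᶠ x in 𝓝 x₀, x ∈ e.baseSet ∧ σ x ∈ e'.baseSet :=
    (e.open_baseSet.eventually_mem hx₀).and
      (σ.continuous.continuousAt.eventually (e'.open_baseSet.eventually_mem hσx₀))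
  have hne : ∀ x, x ∈ e.baseSet ∧ σ x ∈ e'.baseSet →
      conj (Ψ.coeff e e' x) / Ψ.coeff e' e (σ x) ≠ 0 := fun x hx =>
    div_ne_zero ((map_ne_zero _).2 (Ψ.coeff_ne_zero e e' hx.1 hx.2))
      (Ψ.coeff_ne_zero e' e hx.2 (by rw [hσ_inv x]; exact hx.1))
  set w : D → ℂ := fun x => conj (Ψ.coeff e e' x) / Ψ.coeff e' e (σ x) with hw
  have hwd : ∀ᶠ x in 𝓝 x₀, MDifferentiableAt 𝓘(ℂ, E) 𝓘(ℂ, ℂ) w x := by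
    filter_upwards [h1, h3, hbase] with x hx1 hx3 hx
    have hinv : DifferentiableAt ℂ (fun z : ℂ => z⁻¹) (Ψ.coeff e' e (σ x)) :=
      differentiableAt_inv (Ψ.coeff_ne_zero e' e hx.2 (by rw [hσ_inv x]; exact hx.1))
    have h4 := hx1.mul (hinv.mdifferentiableAt.comp x hx3)
    refine h4.congr_of_eventuallyEq (Filter.Eventually.of_forall fun y => ?_)
    exact div_eq_mul_inv _ _
  obtain ⟨S, hS⟩ := exists_holomorphic_sqrt (hne x₀ hbase.self_of_nhds)
  refine ⟨fun x => S (w x), ?_⟩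
  filter_upwards [hwd.self_of_nhds.continuousAt.eventually hS, hwd, hbase] with x hx hxw hxb
  refine ⟨hx.1.mdifferentiableAt.comp x hxw, fun h0 => hne x hxb ?_, hx.2⟩
  change w x = 0
  rw [← hx.2, h0, zero_pow two_ne_zero]

end Lift

/-! ### Equivariance of the representing vectors -/

section Representation

open scoped InnerProductSpace

variable {EH : Type*} [NormedAddCommGroup EH] [NormedSpace ℝ EH]
  {H : Type*} [Group H] [TopologicalSpace H] [ChartedSpace EH H]
  {V : Type*} [NormedAddCommGroup V] [InnerProductSpace ℂ V] [CompleteSpace V]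
  {ρ : H →* unitary (V →L[ℂ] V)}
  [FiniteDimensional ℂ E] [IsManifold 𝓘(ℂ, E) ω D]
  [VectorBundle ℂ ℂ L] [ContMDiffVectorBundle ω ℂ L 𝓘(ℂ, E)]
  [MulAction H D] [MulAction H (TotalSpace ℂ L)]

theorem inner_unitary_apply_apply (U : unitary (V →L[ℂ] V)) (v w : V) :
    ⟪(U : V →L[ℂ] V) v, (U : V →L[ℂ] V) w⟫_ℂ = ⟪v, w⟫_ℂ := by
  rw [← ContinuousLinearMap.adjoint_inner_left, ← ContinuousLinearMap.comp_apply,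
    ← ContinuousLinearMap.star_eq_adjoint, ← ContinuousLinearMap.mul_def, Unitary.star_mul_self_of_mem U.2]
  rfl

theorem map_inv_map_apply (h : H) (v : V) :
    (ρ h : V →L[ℂ] V) ((ρ h⁻¹ : V →L[ℂ] V) v) = v := by
  have h1 : (ρ h : V →L[ℂ] V) * (ρ h⁻¹ : V →L[ℂ] V) = 1 := by
    rw [← Submonoid.coe_mul, ← map_mul, mul_inv_cancel, map_one]
    rfl
  exact congrArg (fun B : V →L[ℂ] V => B v) h1

variable (hL : IsEquivariantHolomorphicLineBundle E EH H L) {T : V →L[ℂ] HolomorphicSection E L}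
  (hT : ∀ (h : H) (f : V) (x : D),
    (⟨h • x, T ((ρ h : V →L[ℂ] V) f) (h • x)⟩ : TotalSpace ℂ L) = h • ⟨x, T f x⟩)
  (e e' : Trivialization ℂ (π ℂ L)) [MemTrivializationAtlas e] [MemTrivializationAtlas e']

include hL hT

theorem evalCoord_smul (h : H) {x : D} (hx : x ∈ e.baseSet) (hhx : h • x ∈ e'.baseSet) (f : V) :
    evalCoord T e' (h • x) ((ρ h : V →L[ℂ] V) f) =
      (e' (h • e.frame x)).2 * evalCoord T e x f := by
  rw [evalCoord_apply T e' hhx, evalCoord_apply T e hx, hT,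
    snd_smul_eq_mul e hL e' h (p := ⟨x, T f x⟩) hx hhx, mul_comm]

/-- Unitarity moves `ρ h` across the inner product; the scalar is conjugated because a representing
vector depends conjugate-linearly on its functional. -/
theorem coordVector_smul (h : H) {x : D} (hx : x ∈ e.baseSet) (hhx : h • x ∈ e'.baseSet) :
    coordVector T e' (h • x) =
      conj (e' (h • e.frame x)).2 • (ρ h : V →L[ℂ] V) (coordVector T e x) := by
  refine ext_inner_right ℂ fun f => ?_
  rw [inner_coordVector, ← map_inv_map_apply (ρ := ρ) h f, evalCoord_smul hL hT e e' h hx hhx,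
    inner_smul_left, inner_unitary_apply_apply, inner_coordVector, Complex.conj_conj]

theorem norm_coordVector_smul (h : H) {x : D} (hx : x ∈ e.baseSet) (hhx : h • x ∈ e'.baseSet) :
    ‖coordVector T e' (h • x)‖ = ‖(e' (h • e.frame x)).2‖ * ‖coordVector T e x‖ := by
  rw [coordVector_smul hL hT e e' h hx hhx, norm_smul, RCLike.norm_conj]
  congr 1
  rw [@norm_eq_sqrt_re_inner ℂ, @norm_eq_sqrt_re_inner ℂ, inner_unitary_apply_apply]

variable {σ : C(D, D)} (hσ_inv : Function.Involutive σ)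
  (Ψ : HolomorphicLineBundleIso E L (σ *ᵖ (ConjBundle L))) (hΨ : Ψ.IsEquivariant H)

include hσ_inv hΨ

/-- For `g` moving `x` to `σ x`, the modulus of `g : L x → L (σ x)` in the local frames is determined
by the coefficients of `Ψ`, unless all sections in the range of `T` vanish at `x`. -/
theorem norm_snd_smul_frame_sq {g : H} {x : D} (hg : σ x = g • x) (hx : x ∈ e.baseSet)
    (hσx : σ x ∈ e'.baseSet) (h0 : coordVector T e x ≠ 0) :
    ‖(e' (g • e.frame x)).2‖ ^ 2 * ‖Ψ.coeff e' e (σ x)‖ = ‖Ψ.coeff e e' x‖ := by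
  obtain ⟨h', hh'⟩ := hΨ g (e.frame x)
  have hproj : (g • e.frame x).proj = σ x := by rw [proj_smul hL, e.frame_proj, hg]
  have hlproj : (Ψ.lift (e.frame x)).proj = σ x := rfl
  -- Base points in `hh'`: `Ψ` sends the fibre at `σ x` to the fibre at `σ (σ x) = x`.
  have hh'x : h' • σ x = x := by
    have h1 := congrArg TotalSpace.proj hh'
    rw [proj_smul hL, hlproj] at h1
    rw [← h1]
    change σ (g • e.frame x).proj = x
    rw [hproj, hσ_inv]
  have h1 := congrArg (fun p => (e p).2) hh'
  rw [Ψ.snd_lift e' e (by rwa [hproj]) (by rwa [hproj, hσ_inv]), hproj,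
    snd_smul_eq_mul e' hL e h' (by rwa [hlproj]) (by rwa [hlproj, hh'x]), hlproj] at h1
  have h2 := congrArg norm h1
  rw [norm_mul, norm_mul, RCLike.norm_conj] at h2
  have h3 := norm_coordVector_smul hL hT e e' g hx (by rwa [← hg])
  have h4 := norm_coordVector_smul hL hT e' e h' hσx (by rwa [hh'x])
  rw [← hg] at h3
  rw [hh'x, h3] at h4
  -- `h' * g` fixes `x` and acts on `L x` by a scalar of modulus `1`, since it acts on the nonzero
  -- vector `coordVector T e x` through a unitary operator.
  have h5 : ‖(e (h' • e'.frame (σ x))).2‖ * ‖(e' (g • e.frame x)).2‖ = 1 := by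
    refine mul_right_cancel₀ (norm_ne_zero_iff.2 h0) ?_
    rw [one_mul, mul_assoc, ← h4]
  change _ = ‖Ψ.coeff e e' x‖ * _ at h2
  rw [sq, mul_assoc, h2, mul_comm ‖Ψ.coeff e e' x‖, ← mul_assoc, mul_comm ‖(e' _).2‖, h5, one_mul]

/-- `A` commutes with the unitary `ρ g`, so passing from `x` to `σ x = g • x` only multiplies the
diagonal coefficient by the squared modulus of the coordinate of `g`. That modulus is `‖q‖`,
whichever `g` is used. -/
theorem inner_coordVector_apply_eq {x : D} (hσ_orbit : ∃ g : H, σ x = g • x) (hx : x ∈ e.baseSet)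
    (hσx : σ x ∈ e'.baseSet) {A : V →L[ℂ] V} (hA : A ∈ intertwiningOperators ρ) {q : ℂ}
    (hq : q ^ 2 = conj (Ψ.coeff e e' x) / Ψ.coeff e' e (σ x)) :
    ⟪coordVector T e' (σ x), A (coordVector T e' (σ x))⟫_ℂ =
      ⟪conj q • coordVector T e x, A (conj q • coordVector T e x)⟫_ℂ := by
  obtain ⟨g, hg⟩ := hσ_orbit
  have hAg : ∀ v, A ((ρ g : V →L[ℂ] V) v) = (ρ g : V →L[ℂ] V) (A v) := fun v =>
    (congrArg (fun B : V →L[ℂ] V => B v)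
      ((Subalgebra.mem_centralizer_iff ℂ).1 hA _ ⟨g, rfl⟩)).symm
  have h1 := coordVector_smul hL hT e e' g hx (by rwa [← hg])
  rw [← hg] at h1
  rw [h1]
  simp only [map_smul, inner_smul_left, inner_smul_right, hAg, inner_unitary_apply_apply,
    Complex.conj_conj]
  -- Where all sections in the range of `T` vanish, the modulus of `g` is not controlled, but both
  -- sides are `0`.
  by_cases h0 : coordVector T e x = 0
  · simp [h0]
  have hψ' : Ψ.coeff e' e (σ x) ≠ 0 := Ψ.coeff_ne_zero e' e hσx (by rwa [hσ_inv])
  have h2 := norm_snd_smul_frame_sq hL hT e e' hσ_inv Ψ hΨ hg hx hσx h0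
  have h3 : ‖q‖ ^ 2 * ‖Ψ.coeff e' e (σ x)‖ = ‖Ψ.coeff e e' x‖ := by
    rw [← norm_pow, ← norm_mul, hq, div_mul_cancel₀ _ hψ', RCLike.norm_conj]
  have h4 := mul_right_cancel₀ (norm_ne_zero_iff.2 hψ') (h2.trans h3.symm)
  rw [← mul_assoc, ← mul_assoc, Complex.conj_mul', Complex.conj_mul',
    ← Complex.ofReal_pow, h4, Complex.ofReal_pow]

/-- Near `x₀`, in a chart, there are a weakly anti-holomorphic family `k` and a weakly holomorphic
family `l` of vectors, each total in `V`, whose diagonal matrix coefficients agree for every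
intertwining operator. -/
theorem exists_families [ConnectedSpace D] (hT_inj : Function.Injective T)
    (hσ : IsAntiholomorphic E σ) (hσ_orbit : ∀ x : D, ∃ g : H, σ x = g • x) (x₀ : D) :
    ∃ (z₀ : E) (r C : ℝ) (k l : E → V),
      (∀ f : V, DifferentiableOn ℂ (fun z => ⟪k z, f⟫_ℂ) (Metric.ball z₀ (3 * r))) ∧
      (∀ f : V, DifferentiableOn ℂ (fun z => ⟪f, l z⟫_ℂ) (Metric.ball z₀ (3 * r))) ∧
      (∀ z ∈ Metric.ball z₀ (3 * r), ‖k z‖ ≤ C) ∧ (∀ z ∈ Metric.ball z₀ (3 * r), ‖l z‖ ≤ C) ∧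
      (∀ A ∈ intertwiningOperators ρ, ∀ z ∈ Metric.ball z₀ (3 * r),
        ⟪l z, A (l z)⟫_ℂ = ⟪k z, A (k z)⟫_ℂ) ∧
      (∀ f : V, (∀ z ∈ Metric.ball z₀ r, ⟪k z, f⟫_ℂ = 0) → f = 0) ∧
      (∀ f : V, (∀ z ∈ Metric.ball z₀ r, ⟪l z, f⟫_ℂ = 0) → f = 0) := by
  set e := trivializationAt ℂ L x₀ with he
  set e' := trivializationAt ℂ L (σ x₀) with he'
  have hx₀ : x₀ ∈ e.baseSet := mem_baseSet_trivializationAt ℂ L x₀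
  have hσx₀ : σ x₀ ∈ e'.baseSet := mem_baseSet_trivializationAt ℂ L (σ x₀)
  obtain ⟨q, hq⟩ := Ψ.exists_sqrt_coeff_div hσ hσ_inv x₀
  rw [← he, ← he'] at hq
  obtain ⟨C₁, hC₁⟩ := exists_norm_coordVector_le T e hx₀
  obtain ⟨C₂, hC₂⟩ := exists_norm_coordVector_le T e' hσx₀
  have hqC : ∀ᶠ x in 𝓝 x₀, ‖q x‖ ≤ ‖q x₀‖ + 1 :=
    hq.self_of_nhds.1.continuousAt.norm.eventually (eventually_le_nhds (by simp))
  have hall := hq.and (hC₁.and ((σ.continuous.continuousAt.eventually hC₂).and (hqC.and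
    ((e.open_baseSet.eventually_mem hx₀).and
      (σ.continuous.continuousAt.eventually (e'.open_baseSet.eventually_mem hσx₀))))))
  set φ := chartAt E x₀
  have hφx₀ : x₀ ∈ φ.source := mem_chart_source E x₀
  have hall2 := (φ.tendsto_symm hφx₀).eventually hall
  obtain ⟨R, hR, hball⟩ := Metric.eventually_nhds_iff_ball.1
    (hall2.and (φ.open_target.eventually_mem (φ.map_source hφx₀)))
  -- Polarization between points of the ball of radius `r` uses the ball of radius `3 * r`.
  obtain ⟨r, rfl⟩ : ∃ r, R = 3 * r := ⟨R / 3, by ring⟩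
  have hr : 0 < r := by linarith
  have hN : ∀ᶠ x in 𝓝 x₀, x ∈ φ.source ∧ φ x ∈ Metric.ball (φ x₀) r :=
    (φ.open_source.eventually_mem hφx₀).and
      ((φ.continuousAt hφx₀).eventually (Metric.ball_mem_nhds _ hr))
  have hrr : Metric.ball (φ x₀) r ⊆ Metric.ball (φ x₀) (3 * r) :=
    Metric.ball_subset_ball (by linarith)
  refine ⟨φ x₀, r, max ((‖q x₀‖ + 1) * C₁) C₂,
    -- The conjugate of `q` keeps `k` anti-holomorphic, while `‖q‖²` absorbs the factor relating the
    -- diagonals at `x` and `σ x`.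
    fun z => conj (q (φ.symm z)) • coordVector T e (φ.symm z),
    fun z => coordVector T e' (σ (φ.symm z)), ?_, ?_, ?_, ?_, ?_, ?_, ?_⟩
  · intro f z hz
    obtain ⟨⟨hqz, -, -, -, hxe, -⟩, hzt⟩ := hball z hz
    simp only [inner_smul_left, inner_coordVector, Complex.conj_conj]
    exact ((hqz.1.mul (mdifferentiableAt_evalCoord T e f
      hxe)).differentiableAt_comp_chart_symm hzt).differentiableWithinAt
  · intro f z hz
    obtain ⟨⟨-, -, -, -, -, hxe⟩, hzt⟩ := hball z hz
    have h1 := hσ.mdifferentiableAt_conj_comp (mdifferentiableAt_evalCoord T e' f hxe)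
    refine (h1.differentiableAt_comp_chart_symm hzt).differentiableWithinAt.congr_of_eventuallyEq
      (Filter.Eventually.of_forall fun y => ?_) ?_ <;>
    · beta_reduce
      rw [← inner_conj_symm, inner_coordVector]
  · intro z hz
    obtain ⟨⟨-, hC, -, hqz, -, -⟩, -⟩ := hball z hz
    rw [norm_smul, RCLike.norm_conj]
    exact (mul_le_mul hqz hC (norm_nonneg _) (by positivity)).trans (le_max_left _ _)
  · intro z hz
    obtain ⟨⟨-, -, hC, -, -, -⟩, -⟩ := hball z hz
    exact hC.trans (le_max_right _ _)
  · intro A hA z hz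
    obtain ⟨⟨hqz, -, -, -, hxe, hxe'⟩, -⟩ := hball z hz
    exact inner_coordVector_apply_eq hL hT e e' hσ_inv Ψ hΨ (hσ_orbit _) hxe hxe' hA hqz.2.2
  · intro f hf
    refine hT_inj (((T f).eq_zero_of_eventually_eq_zero (x₀ := x₀) ?_).trans (map_zero T).symm)
    filter_upwards [hN] with x hx
    obtain ⟨⟨hqz, -, -, -, hxe, -⟩, -⟩ := hball _ (hrr hx.2)
    have h1 := hf _ hx.2
    beta_reduce at h1
    rw [φ.left_inv hx.1] at h1 hqz hxe
    rw [inner_smul_left, Complex.conj_conj, inner_coordVector, evalCoord_apply T e hxe] at h1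
    exact (e.snd_eq_zero_iff_of_mem hxe _).1 ((mul_eq_zero.1 h1).resolve_left hqz.2.1)
  · intro f hf
    -- The vectors `l z` evaluate sections at `σ x` for `x` near `x₀`, so the identity theorem is
    -- applied at `σ x₀`.
    refine hT_inj (((T f).eq_zero_of_eventually_eq_zero (x₀ := σ x₀) ?_).trans (map_zero T).symm)
    have hlim : Filter.Tendsto σ (𝓝 (σ x₀)) (𝓝 x₀) :=
      σ.continuous.tendsto' _ _ (hσ_inv x₀)
    filter_upwards [hlim.eventually hN] with y hy
    obtain ⟨⟨-, -, -, -, -, hxe⟩, -⟩ := hball _ (hrr hy.2)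
    have h1 := hf _ hy.2
    beta_reduce at h1
    rw [φ.left_inv hy.1, hσ_inv] at h1 hxe
    rw [inner_coordVector, evalCoord_apply T e' hxe] at h1
    exact (e'.snd_eq_zero_iff_of_mem hxe _).1 h1

end Representation

end LineBundle

/-! ### The multiplicity-freeness theorem -/

theorem theorem2p2
    -- a Lie group `H`
    {EH : Type*} [NormedAddCommGroup EH] [NormedSpace ℝ EH] [FiniteDimensional ℝ EH]
    {H : Type*} [Group H] [TopologicalSpace H] [ChartedSpace EH H] [LieGroup 𝓘(ℝ, EH) ∞ H]
    -- a unitary representation of `H` on a Hilbert space `V`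
    {V : Type*} [NormedAddCommGroup V] [InnerProductSpace ℂ V] [CompleteSpace V]
    (ρ : H →* unitary (V →L[ℂ] V)) (hρ : ∀ f : V, Continuous fun h : H => (ρ h : V →L[ℂ] V) f)
    -- a connected complex manifold `D`
    {E : Type*} [NormedAddCommGroup E] [NormedSpace ℂ E] [FiniteDimensional ℂ E]
    {D : Type*} [TopologicalSpace D] [ChartedSpace E D] [IsManifold 𝓘(ℂ, E) ω D]
    [T2Space D] [ConnectedSpace D]
    -- an `H`-equivariant holomorphic line bundle `L` on `D`
    {L : D → Type*} [∀ x, AddCommGroup (L x)] [∀ x, Module ℂ (L x)]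
    [TopologicalSpace (TotalSpace ℂ L)] [∀ x, TopologicalSpace (L x)] [FiberBundle ℂ L]
    [VectorBundle ℂ ℂ L] [ContMDiffVectorBundle ω ℂ L 𝓘(ℂ, E)]
    [MulAction H D] [MulAction H (TotalSpace ℂ L)]
    (hL : IsEquivariantHolomorphicLineBundle E EH H L)
    -- an anti-holomorphic involution `σ` of `D`
    (σ : C(D, D)) (hσ : IsAntiholomorphic E σ) (hσ_inv : Function.Involutive σ)
    -- an injective continuous `H`-intertwining map from `V` to the holomorphic sections of `L`
    (T : V →L[ℂ] HolomorphicSection E L) (hT_inj : Function.Injective T)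
    (hT : ∀ (h : H) (f : V) (x : D),
      (⟨h • x, T ((ρ h : V →L[ℂ] V) f) (h • x)⟩ : TotalSpace ℂ L) = h • ⟨x, T f x⟩)
    -- an equivariant isomorphism of `L` with the conjugate of the pull-back of `L` along `σ`
    (Ψ : HolomorphicLineBundleIso E L (σ *ᵖ (ConjBundle L))) (hΨ : Ψ.IsEquivariant H)
    -- `σ` preserves each orbit of `H`
    (hσ_orbit : ∀ x : D, ∃ g : H, σ x = g • x) :
    (∀ A B : V →L[ℂ] V, A ∈ intertwiningOperators ρ → B ∈ intertwiningOperators ρ →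
      A * B = B * A) ∧ IsMultiplicityFree ρ := by
  have hcomm : ∀ A B : V →L[ℂ] V, A ∈ intertwiningOperators ρ → B ∈ intertwiningOperators ρ →
      A * B = B * A := by
    intro A B hA hB
    obtain ⟨x₀⟩ := (inferInstance : Nonempty D)
    obtain ⟨z₀, r, C, k, l, hk, hl, hkC, hlC, hdiag, hk_total, hl_total⟩ :=
      exists_families hL hT hσ_inv Ψ hΨ hT_inj hσ hσ_orbit x₀
    -- The families are indexed by the small ball only: they are already total there, and
    -- polarization is available for all its pairs of points.
    exact mul_comm_of_inner_eq (k := fun z : Metric.ball z₀ r => k z)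
      (l := fun z : Metric.ball z₀ r => l z)
      (fun f hf => hk_total f fun z hz => hf ⟨z, hz⟩)
      (fun f hf => hl_total f fun z hz => hf ⟨z, hz⟩) (intertwiningOperators ρ).toSubmonoid
      (fun A hA x y => inner_eq_of_inner_self_eq hk hl hkC hlC A (hdiag A hA) x.2 y.2) hA hB
  exact ⟨hcomm, fun A B => Subtype.ext (hcomm A B A.2 B.2)⟩
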